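/- **Setting.** Let $k$ be a commutative ring with $\mathbb{Q}\subseteq k$, let $A$ be an associative unital $k$-algebra, $K\subseteq A$ a $k$-subalgebra, and $M$ an $A$-bimodule (with symmetric $k$-action) with an associative $A$-bimodule map $M\otimes_A M\to M$, $m\otimes m'\mapsto m\triangledown m'$. Put $\overline{A}=A/K$. All tensor products are over $K$. For $v,w\ge 0$ and $n=v+w$, let $X_{vw}$ be the direct sum of the cyclic tensor products $X_0\otimes X_1\otimes\cdots\otimes X_n\otimes$ (that is, the quotient of $X_0\otimes\cdots\otimes X_n$ by the commutators with $K$) over all choices with $X_0=M$, $X_i=M$ for exactly $w$ indices $i\in\{1,\dots,n\}$, and $X_i=\overline{A}$ for the other $v$ indices; put $X_{v,-1}=0$. Extend $\triangledown$ by $x\triangledown y=0$ unless $x,y\in M$. For a simple tensor $x_0\otimes\cdots\otimes x_n$ with all $x_i$ in $\overline{A}$ or $M$, define $$t(x_0\otimes\cdots\otimes x_n)=(-1)^{in}\,x_i\otimes\cdots\otimes x_n\otimes x_0\otimes\cdots\otimes x_{i-1},$$ where $i$ is the last index with $x_i\in M$, and, as maps $X_{vw}\to X_{v,w-1}$, $$\varrho_j(x_0\otimes\cdots\otimes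 x_n)=(-1)^j x_0\otimes\cdots\otimes (x_j\triangledown x_{j+1})\otimes\cdots\otimes x_n\quad(0\le j<n),$$ $$\varrho_n(x_0\otimes\cdots\otimes x_n)=(-1)^n (x_n\triangledown x_0)\otimes x_1\otimes\cdots\otimes x_{n-1},$$ (with $\varrho_n=0$ for $n=0$). Put $d'=\sum_{j=0}^{n-1}\varrho_j$, $d=d'+\varrho_n$ and, on $X_{vw}$, $N=\sum_{l=0}^{w}t^l$ and $\sigma'=\sum_{j=0}^{w-1}\frac{w-j}{w+1}t^j$. Let $\ddot X_{vw}=X_{vw}\oplus X_{v,w-1}$ with the operator $\ddot\kappa(x,y)=(t(x),\,t(y)+d'(x)-d(x))$. Let $\overline{X}_{vw}$ be the cokernel of $1-t$ on $X_{vw}$, with class map $x\mapsto[x]$; let $\overline N\colon\overline X_{vw}\to X_{vw}$ be induced by $N$, $\mathfrak p\colon X_{vw}\to\overline X_{vw}$, $\mathfrak p(x)=\frac1{w+1}[x]$, and $\widetilde X_{vw}=\overline X_{vw}\oplus\overline X_{v,w-1}$. Put $\Upsilon=(-1+\overline N\mathfrak p)\,\sigma' d\colon X_{vw}\to X_{v,w-1}$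 (zero for $w=0$) and $$\Psi(x,y)=\tfrac1{w+1}\bigl(\overline N(x),\Upsilon\overline N(x)\bigr)+\bigl(0,\overline N(y)\bigr)\qquad\text{for }(x,y)\in\widetilde X_{vw}.$$ **Statement.** For all $v,w\ge 0$: $\ddot X_{vw}=\ker(\ddot\kappa-1)^2\oplus\operatorname{im}(\ddot\kappa-1)^2$; let $P$ be the projection onto the first summand along the second. The map $\Psi$ is an isomorphism of $\widetilde X_{vw}$ onto $P(\ddot X_{vw})=\ker(\ddot\kappa-1)^2$, and the map $\widetilde P=\Psi^{-1}\circ P\colon\ddot X_{vw}\to\widetilde X_{vw}$ satisfies $$\widetilde P(0,y)=\frac1w\,(0,[y])\qquad\text{for }w>0,$$ $$\widetilde P(x,0)=\begin{cases}([x],0)&\text{if }w=0,\\[4pt] ([x],0)+\displaystyle\sum_{i=0}^{w}\frac{2i-w}{2w(w+1)}\,\bigl(0,[\varrho_n t^i(x)]\bigr)&\text{if }w>0,\end{cases}$$ where $x\in X_{vw}$, $y\in X_{v,w-1}$ and $n=v+w$. -/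

import Mathlib

set_option linter.unusedSectionVars false

namespace CleftExt

/-- An associative `A`-bimodule map `M ⊗_A M → M`, `m ⊗ m' ↦ m ▿ m'`, given as an `A`-balanced
`k`-bilinear map on `M × M`. Right multiplication by `a` on `M` is `MulOpposite.op a • _`. -/
structure AssocBimoduleMap (k A M : Type*) [CommRing k] [Ring A] [Algebra k A]
    [AddCommGroup M] [Module k M] [Module A M] [Module Aᵐᵒᵖ M] where
  toLin : M →ₗ[k] M →ₗ[k] M
  map_left : ∀ (a : A) (m m' : M), toLin (a • m) m' = a • toLin m m'
  map_right : ∀ (a : A) (m m' : M),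
    toLin m (MulOpposite.op a • m') = MulOpposite.op a • toLin m m'
  balanced : ∀ (a : A) (m m' : M), toLin (MulOpposite.op a • m) m' = toLin m (a • m')
  assoc : ∀ m m' m'' : M, toLin (toLin m m') m'' = toLin m (toLin m' m'')

section

variable {k A : Type*} (M : Type*) [CommRing k] [Ring A] [Algebra k A]
  [AddCommGroup M] [Module k M] [Module A M] [Module Aᵐᵒᵖ M] [IsScalarTower k A M]
  [IsScalarTower k Aᵐᵒᵖ M] (K : Subalgebra k A)

/-- For `E = A ⋉ M` this is the `K`-bimodule `E / K = (A / K) ⊕ M`. -/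
abbrev EBar : Type _ := (A ⧸ Subalgebra.toSubmodule K) × M

/-- Left action of `c ∈ K` on `E / K`. -/
def lAct (c : K) : EBar M K →ₗ[k] EBar M K :=
  LinearMap.prodMap
    (Submodule.mapQ _ _ (LinearMap.mulLeft k (c : A)) (fun _ hx => K.mul_mem c.2 hx))
    (Algebra.lsmul k k M (c : A))

/-- Right action of `c ∈ K` on `E / K`. -/
def rAct (c : K) : EBar M K →ₗ[k] EBar M K :=
  LinearMap.prodMap
    (Submodule.mapQ _ _ (LinearMap.mulRight k (c : A)) (fun _ hx => K.mul_mem hx c.2))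
    (Algebra.lsmul k k M (MulOpposite.op (c : A)))

/-- The projection of `E / K` onto its summand `M`. -/
def prM : EBar M K →ₗ[k] EBar M K := (LinearMap.inr k _ _).comp (LinearMap.snd k _ _)

/-- The projection of `E / K` onto its summand `A / K`. -/
def prA : EBar M K →ₗ[k] EBar M K := (LinearMap.inl k _ _).comp (LinearMap.fst k _ _)

/-- The `N`-fold tensor power of `E / K` over `k`. -/
abbrev TPow (N : ℕ) : Type _ := PiTensorProduct k (fun _ : Fin N => EBar M K)

/-- The relations `⋯ ⊗ x_i c ⊗ x_{i+1} ⊗ ⋯ = ⋯ ⊗ x_i ⊗ c x_{i+1} ⊗ ⋯` for `c ∈ K`, the indices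
being read cyclically (`finRotate N` is `i ↦ i + 1` modulo `N`). -/
def balRel (N : ℕ) : Submodule k (TPow M K N) :=
  Submodule.span k {z | ∃ (i : Fin N) (c : K) (x : Fin N → EBar M K),
    z = PiTensorProduct.tprod k (Function.update x i (rAct M K c (x i)))
      - PiTensorProduct.tprod k
          (Function.update x (finRotate N i) (lAct M K c (x (finRotate N i))))}

/-- The cyclic tensor product `(E/K) ⊗_K ⋯ ⊗_K (E/K) ⊗_K` with `N` factors: the tensor product
over `K`, divided by its commutators with `K`. -/
abbrev CycT (N : ℕ) : Type _ := TPow M K N ⧸ balRel M K N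

/-- The class of `x_0 ⊗ ⋯ ⊗ x_{N-1}` in the cyclic tensor product. -/
def cls {N : ℕ} (x : Fin N → EBar M K) : CycT M K N :=
  (balRel M K N).mkQ (PiTensorProduct.tprod k x)

variable {M K}

lemma cls_rel {N : ℕ} (i : Fin N) (c : K) (x : Fin N → EBar M K) :
    cls M K (Function.update x i (rAct M K c (x i)))
      = cls M K (Function.update x (finRotate N i) (lAct M K c (x (finRotate N i)))) := by
  unfold cls
  rw [← sub_eq_zero, ← map_sub, Submodule.mkQ_apply, Submodule.Quotient.mk_eq_zero]
  exact Submodule.subset_span ⟨i, c, x, rfl⟩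

/-- A `k`-multilinear map that respects the relations descends to the cyclic tensor product. -/
def cycLift {N : ℕ} {P : Type*} [AddCommGroup P] [Module k P]
    (f : MultilinearMap k (fun _ : Fin N => EBar M K) P)
    (hf : ∀ (i : Fin N) (c : K) (x : Fin N → EBar M K),
      f (Function.update x i (rAct M K c (x i)))
        = f (Function.update x (finRotate N i) (lAct M K c (x (finRotate N i))))) :
    CycT M K N →ₗ[k] P :=
  (balRel M K N).liftQ (PiTensorProduct.lift f) (by
    rw [balRel, Submodule.span_le]
    rintro _ ⟨i, c, x, rfl⟩
    simp only [SetLike.mem_coe, LinearMap.mem_ker, map_sub, PiTensorProduct.lift.tprod]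
    rw [hf, sub_self])

@[simp] lemma cycLift_cls {N : ℕ} {P : Type*} [AddCommGroup P] [Module k P]
    (f : MultilinearMap k (fun _ : Fin N => EBar M K) P) (hf) (x : Fin N → EBar M K) :
    cycLift f hf (cls M K x) = f x := by
  simp [cycLift, cls]

variable (M K)

/-- The class map, as a multilinear map. -/
def clsM (N : ℕ) :
    MultilinearMap k (fun _ : Fin N => EBar M K) (CycT M K N) :=
  (balRel M K N).mkQ.compMultilinearMap (PiTensorProduct.tprod k)

variable {M K}

@[simp] lemma clsM_apply {N : ℕ} (x : Fin N → EBar M K) : clsM M K N x = cls M K x := rfl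

/-! ### Rotation -/

variable (M K)

/-- `x_0 ⊗ x_1 ⊗ ⋯ ⊗ x_{N-1} ↦ x_1 ⊗ ⋯ ⊗ x_{N-1} ⊗ x_0` (no sign). -/
def rot (N : ℕ) : Module.End k (CycT M K N) :=
  cycLift ((clsM M K N).domDomCongr (finRotate N)) (by
    intro i c x
    have key : ∀ (j : Fin N) (v : EBar M K),
        (fun l => Function.update x j v (finRotate N l))
          = Function.update (fun l => x (finRotate N l)) ((finRotate N).symm j) v := by
      intro j v
      funext l
      by_cases h : finRotate N l = j
      · have : l = (finRotate N).symm j := by rw [← h, Equiv.symm_apply_apply]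
        rw [h, Function.update_self, this, Function.update_self]
      · have : l ≠ (finRotate N).symm j := by
          rintro rfl; exact h (Equiv.apply_symm_apply _ _)
        rw [Function.update_of_ne h, Function.update_of_ne this]
    simp only [MultilinearMap.domDomCongr_apply, clsM_apply]
    rw [key, key]
    have := cls_rel ((finRotate N).symm i) c (fun l => x (finRotate N l))
    simpa only [Equiv.apply_symm_apply, Equiv.symm_apply_apply] using this)

lemma val_finRotate {N : ℕ} (i : Fin N) : (finRotate N i : ℕ) = (i + 1) % N := by
  cases N with
  | zero => exact i.elim0
  | succ n =>
    rw [coe_finRotate]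
    split_ifs with h
    · subst h; simp
    · rw [Nat.mod_eq_of_lt]
      have : (i : ℕ) ≠ n := fun h' => h (Fin.ext h')
      omega

lemma val_finRotate_pow {N : ℕ} (a : ℕ) (i : Fin N) :
    ((finRotate N ^ a) i : ℕ) = (i + a) % N := by
  induction a with
  | zero => simp [Nat.mod_eq_of_lt i.2]
  | succ a ih =>
    rw [pow_succ', Equiv.Perm.mul_apply, val_finRotate, ih, Nat.mod_add_mod, add_assoc]

lemma finRotate_pow_self (N : ℕ) : finRotate N ^ N = 1 := by
  ext i
  rw [val_finRotate_pow]
  simp [Nat.mod_eq_of_lt i.2]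

variable {M K}

@[simp] lemma rot_cls {N : ℕ} (x : Fin N → EBar M K) :
    rot M K N (cls M K x) = cls M K (fun i => x (finRotate N i)) := by
  simp only [rot, cycLift_cls, MultilinearMap.domDomCongr_apply, clsM_apply]

lemma rot_pow_cls {N : ℕ} (a : ℕ) (x : Fin N → EBar M K) :
    (rot M K N ^ a) (cls M K x) = cls M K (fun i => x ((finRotate N ^ a) i)) := by
  induction a generalizing x with
  | zero => simp
  | succ a ih =>
    rw [pow_succ, Module.End.mul_apply, rot_cls, ih, pow_succ']
    rfl

/-! ### The operator `t` -/

variable (M K)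

/-- Keeps the factors `x_j` with `j < i`, projects `x_i` to `M` and all later factors to `A / K`:
the component of a tensor in which `i` is the last index whose factor lies in `M`. -/
def cutFam {N : ℕ} (i j : Fin N) : EBar M K →ₗ[k] EBar M K :=
  if j < i then LinearMap.id else if j = i then prM M K else prA M K

variable {M K}

lemma cutFam_rAct {N : ℕ} (i j : Fin N) (c : K) (v : EBar M K) :
    cutFam M K i j (rAct M K c v) = rAct M K c (cutFam M K i j v) := by
  unfold cutFam
  split_ifs <;> simp [prM, prA, rAct]

lemma cutFam_lAct {N : ℕ} (i j : Fin N) (c : K) (v : EBar M K) :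
    cutFam M K i j (lAct M K c v) = lAct M K c (cutFam M K i j v) := by
  unfold cutFam
  split_ifs <;> simp [prM, prA, lAct]

lemma cutFam_update {N : ℕ} (i : Fin N) (x : Fin N → EBar M K) (j : Fin N) (v : EBar M K) :
    (fun l => cutFam M K i l (Function.update x j v l))
      = Function.update (fun l => cutFam M K i l (x l)) j (cutFam M K i j v) := by
  funext l
  by_cases h : l = j
  · subst h; simp
  · simp [Function.update_of_ne h]

variable (M K)

/-- The projection of the cyclic tensor product described at `cutFam`. -/
def cut {N : ℕ} (i : Fin N) : Module.End k (CycT M K N) :=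
  cycLift ((clsM M K N).compLinearMap (cutFam M K i)) (by
    intro j c x
    simp only [MultilinearMap.compLinearMap_apply, clsM_apply]
    rw [cutFam_update, cutFam_update, cutFam_rAct, cutFam_lAct]
    exact cls_rel j c (fun l => cutFam M K i l (x l)))

variable {M K}

@[simp] lemma cut_cls {N : ℕ} (i : Fin N) (x : Fin N → EBar M K) :
    cut M K i (cls M K x) = cls M K (fun l => cutFam M K i l (x l)) := by
  simp [cut]

variable (M K)

/-- With `N = n + 1` factors, `t (x_0 ⊗ ⋯ ⊗ x_n) = (-1)^(i n) x_i ⊗ ⋯ ⊗ x_n ⊗ x_0 ⊗ ⋯ ⊗ x_{i-1}`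
on tensors whose factors lie in `A / K` or `M`, where `i` is the last index with `x_i ∈ M`;
extended linearly. -/
def tAll (N : ℕ) : Module.End k (CycT M K N) :=
  ∑ i : Fin N, ((-1 : k) ^ ((i : ℕ) * (N - 1))) • (rot M K N ^ (i : ℕ) * cut M K i)

variable {M K}

/-! ### The operators `ϱ_j` -/

variable (μ : AssocBimoduleMap k A M)

variable (K) in
/-- `▿` extended to `E / K` by zero: `(a, m) ▿ (a', m') = (0, m ▿ m')`. -/
def nab : EBar M K →ₗ[k] EBar M K →ₗ[k] EBar M K :=
  (μ.toLin.compl₁₂ (LinearMap.snd k _ _) (LinearMap.snd k _ _)).compr₂ (LinearMap.inr k _ _)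

lemma nab_apply (x y : EBar M K) : nab K μ x y = (0, μ.toLin x.2 y.2) := by
  simp [nab]

/-- `(x_0, …, x_N) ↦ (x_0, …, x_{j-1}, x_j ▿ x_{j+1}, x_{j+2}, …, x_N)`. -/
def contrFun {N : ℕ} (j : Fin N) (x : Fin (N + 1) → EBar M K) (l : Fin N) : EBar M K :=
  if l < j then x l.castSucc
  else if l = j then nab K μ (x j.castSucc) (x j.succ)
  else x l.succ

/-- The position of the `i`-th factor after the factors `j` and `j + 1` were multiplied. -/
def collapse {N : ℕ} (j : Fin N) (i : Fin (N + 1)) : Fin N :=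
  if h : (i : ℕ) ≤ j then ⟨i, by omega⟩ else ⟨i - 1, by omega⟩

lemma val_collapse {N : ℕ} (j : Fin N) (i : Fin (N + 1)) :
    (collapse j i : ℕ) = if (i : ℕ) ≤ j then (i : ℕ) else i - 1 := by
  unfold collapse
  split_ifs <;> rfl

/-- How the `i`-th entry enters the contraction, the other entries being fixed. -/
def contrSlot {N : ℕ} (j : Fin N) (x : Fin (N + 1) → EBar M K) (i : Fin (N + 1)) :
    EBar M K →ₗ[k] EBar M K :=
  if i = j.castSucc then (nab K μ).flip (x j.succ)
  else if i = j.succ then nab K μ (x j.castSucc)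
  else LinearMap.id

lemma contrFun_update {N : ℕ} (j : Fin N) (x : Fin (N + 1) → EBar M K) (i : Fin (N + 1))
    (v : EBar M K) :
    contrFun μ j (Function.update x i v)
      = Function.update (contrFun μ j x) (collapse j i) (contrSlot μ j x i v) := by
  funext l
  obtain ⟨l, hl⟩ := l
  obtain ⟨j, hj⟩ := j
  obtain ⟨i, hi⟩ := i
  simp only [contrFun, contrSlot, collapse, Function.update_apply, Fin.ext_iff, Fin.lt_def,
    Fin.val_castSucc, Fin.val_succ]
  split_ifs <;> first
    | rfl
    | (exfalso; simp only [] at *; omega)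
    | (exfalso; omega)

lemma contrFun_slot {N : ℕ} (j : Fin N) (x : Fin (N + 1) → EBar M K) (i : Fin (N + 1)) :
    contrSlot μ j x i (x i) = contrFun μ j x (collapse j i) := by
  obtain ⟨j, hj⟩ := j
  obtain ⟨i, hi⟩ := i
  simp only [contrFun, contrSlot, collapse, Fin.ext_iff, Fin.lt_def,
    Fin.val_castSucc, Fin.val_succ]
  split_ifs <;> first
    | rfl
    | (exfalso; simp only [] at *; omega)
    | (subst_vars; rfl)
    | (simp only [LinearMap.id_apply]; congr 1; simp only [Fin.ext_iff, Fin.val_succ]; omega)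

lemma contrSlot_rAct {N : ℕ} (j : Fin N) (x : Fin (N + 1) → EBar M K) (i : Fin (N + 1))
    (hi : i ≠ j.castSucc) (c : K) (v : EBar M K) :
    contrSlot μ j x i (rAct M K c v) = rAct M K c (contrSlot μ j x i v) := by
  unfold contrSlot
  rw [if_neg hi]
  split_ifs
  · rw [nab_apply, nab_apply]
    simp [rAct, μ.map_right]
  · rfl

lemma contrSlot_lAct {N : ℕ} (j : Fin N) (x : Fin (N + 1) → EBar M K) (i : Fin (N + 1))
    (hi : i ≠ j.succ) (c : K) (v : EBar M K) :
    contrSlot μ j x i (lAct M K c v) = lAct M K c (contrSlot μ j x i v) := by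
  unfold contrSlot
  split_ifs
  · rw [LinearMap.flip_apply, LinearMap.flip_apply, nab_apply, nab_apply]
    simp [lAct, μ.map_left]
  · rfl

lemma collapse_finRotate {N : ℕ} (j : Fin N) (i : Fin (N + 1)) (hi : i ≠ j.castSucc) :
    collapse j (finRotate (N + 1) i) = finRotate N (collapse j i) := by
  obtain ⟨j, hj⟩ := j
  obtain ⟨i, hi'⟩ := i
  have hij : i ≠ j := fun h => hi (Fin.ext h)
  apply Fin.ext
  rw [val_finRotate, val_collapse, val_collapse, val_finRotate]
  simp only []
  by_cases hl : i = N
  · subst hl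
    rw [Nat.mod_self, if_pos (Nat.zero_le _), if_neg (by omega), Nat.sub_add_cancel (by omega),
      Nat.mod_self]
  · have h2 : i + 1 < N + 1 := by omega
    rw [Nat.mod_eq_of_lt h2]
    split_ifs <;> rw [Nat.mod_eq_of_lt] <;> omega

variable (K) in
/-- `x_0 ⊗ ⋯ ⊗ x_N ↦ x_0 ⊗ ⋯ ⊗ x_j ▿ x_{j+1} ⊗ ⋯ ⊗ x_N` (no sign). -/
def contr {N : ℕ} (j : Fin N) : CycT M K (N + 1) →ₗ[k] CycT M K N :=
  cycLift
    { toFun := fun x => cls M K (contrFun μ j x)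
      map_update_add' := by
        intro inst x i v w
        rw [Subsingleton.elim inst (instDecidableEqFin _)]
        rw [contrFun_update, contrFun_update, contrFun_update, map_add]
        exact (clsM M K N).map_update_add _ _ _ _
      map_update_smul' := by
        intro inst x i a v
        rw [Subsingleton.elim inst (instDecidableEqFin _)]
        rw [contrFun_update, contrFun_update, map_smul]
        exact (clsM M K N).map_update_smul _ _ _ _ }
    (by
      intro i c x
      simp only [MultilinearMap.coe_mk]
      rw [contrFun_update, contrFun_update]
      by_cases hi : i = j.castSucc
      · subst hi
        have h1 : finRotate (N + 1) j.castSucc = j.succ := by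
          rw [finRotate_apply, Fin.coeSucc_eq_succ]
        have h2 : collapse j j.castSucc = j := by simp [collapse]
        have h3 : collapse j j.succ = j := by simp [collapse]
        have h4 : j.succ ≠ j.castSucc := by simp [Fin.ext_iff]
        rw [h1, h2, h3]
        congr 2
        simp only [contrSlot, if_pos, if_neg h4, LinearMap.flip_apply]
        rw [nab_apply, nab_apply]
        simp [rAct, lAct, μ.balanced]
      · have hi' : finRotate (N + 1) i ≠ j.succ := by
          have h1 : finRotate (N + 1) j.castSucc = j.succ := by
            rw [finRotate_apply, Fin.coeSucc_eq_succ]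
          rw [← h1]
          exact fun h => hi ((finRotate (N + 1)).injective h)
        rw [contrSlot_rAct μ j x i hi, contrSlot_lAct μ j x _ hi', contrFun_slot, contrFun_slot,
          collapse_finRotate j i hi]
        exact cls_rel (collapse j i) c (contrFun μ j x))

@[simp] lemma contr_cls {N : ℕ} (j : Fin N) (x : Fin (N + 1) → EBar M K) :
    contr K μ j (cls M K x) = cls M K (contrFun μ j x) := by
  simp [contr]

variable (K) in
/-- The operator `ϱ_j`, `0 ≤ j ≤ n`, on tensors `x_0 ⊗ ⋯ ⊗ x_n`. For `j < n` it is
`(-1)^j x_0 ⊗ ⋯ ⊗ x_j ▿ x_{j+1} ⊗ ⋯ ⊗ x_n`, and for `j = n > 0` it is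
`(-1)^n x_n ▿ x_0 ⊗ x_1 ⊗ ⋯ ⊗ x_{n-1}`, where `rot ^ n` moves the last factor to the front. -/
def rhoAll (n j : ℕ) : CycT M K (n + 1) →ₗ[k] CycT M K n :=
  if h : j < n then ((-1 : k) ^ j) • contr K μ ⟨j, h⟩
  else if h0 : 0 < n then ((-1 : k) ^ n) • (contr K μ ⟨0, h0⟩ ∘ₗ (rot M K (n + 1) ^ n))
  else 0

/-! ### The modules `X` -/

/-- `x_i ∈ M` for `i ∈ s` and `x_i ∈ A / K` for `i ∉ s`. -/
def IsTyped {N : ℕ} (s : Finset (Fin N)) (x : Fin N → EBar M K) : Prop :=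
  (∀ i ∈ s, (x i).1 = 0) ∧ ∀ i ∉ s, (x i).2 = 0

variable (M K)

/-- The submodule of the cyclic tensor product with `N` factors spanned by the simple tensors
whose factors lie in `A / K` or in `M`, with `x_0 ∈ M` and exactly `m` factors in `M`. -/
def relX (N m : ℕ) : Submodule k (CycT M K N) :=
  Submodule.span k {z | ∃ (s : Finset (Fin N)) (x : Fin N → EBar M K),
    s.card = m ∧ (∃ i ∈ s, (i : ℕ) = 0) ∧ IsTyped s x ∧ z = cls M K x}

variable {M K}

lemma cls_eq_zero {N : ℕ} {x : Fin N → EBar M K} (i : Fin N) (h : x i = 0) : cls M K x = 0 :=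
  (clsM M K N).map_coord_zero i h

lemma mem_relX {N m : ℕ} {s : Finset (Fin N)} {x : Fin N → EBar M K} (hs : s.card = m)
    (h0 : ∃ i ∈ s, (i : ℕ) = 0) (hx : IsTyped s x) : cls M K x ∈ relX M K N m :=
  Submodule.subset_span ⟨s, x, hs, h0, hx, rfl⟩

lemma isTyped_rot {N : ℕ} {s : Finset (Fin N)} {x : Fin N → EBar M K} (hx : IsTyped s x)
    (σ : Equiv.Perm (Fin N)) :
    IsTyped (s.map σ.symm.toEmbedding) (fun i => x (σ i)) := by
  refine ⟨fun i hi => hx.1 _ ?_, fun i hi => hx.2 _ ?_⟩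
  · simpa [Finset.mem_map_equiv] using hi
  · simpa [Finset.mem_map_equiv] using hi

lemma tAll_cls {N : ℕ} {s : Finset (Fin N)} {x : Fin N → EBar M K} (hx : IsTyped s x)
    {i : Fin N} (hi : i ∈ s) (hmax : ∀ j ∈ s, j ≤ i) :
    tAll M K N (cls M K x)
      = ((-1 : k) ^ ((i : ℕ) * (N - 1))) • cls M K (fun l => x ((finRotate N ^ (i : ℕ)) l)) := by
  rw [tAll, LinearMap.sum_apply, Finset.sum_eq_single i]
  · rw [LinearMap.smul_apply, Module.End.mul_apply, cut_cls]
    have : (fun l => cutFam M K i l (x l)) = x := by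
      funext l
      unfold cutFam
      split_ifs with h1 h2
      · rfl
      · subst h2
        exact Prod.ext (by simp [prM, hx.1 l hi]) (by simp [prM])
      · have hl : l ∉ s := fun hl =>
          h1 (lt_of_le_of_ne (hmax l hl) h2)
        exact Prod.ext (by simp [prA]) (by simp [prA, hx.2 l hl])
    rw [this, rot_pow_cls]
  · intro j _ hj
    rw [LinearMap.smul_apply, Module.End.mul_apply, cut_cls]
    have : cls M K (fun l => cutFam M K j l (x l)) = 0 := by
      by_cases hjs : j ∈ s
      · have hji : j < i := lt_of_le_of_ne (hmax j hjs) hj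
        apply cls_eq_zero i
        simp [cutFam, not_lt.mpr hji.le, hji.ne', prA, hx.1 i hi]
      · apply cls_eq_zero j
        simp [cutFam, prM, hx.2 j hjs]
    rw [this, map_zero, smul_zero]
  · intro h; exact absurd (Finset.mem_univ _) h

lemma tAll_mem {N m : ℕ} : ∀ z ∈ relX M K N m, tAll M K N z ∈ relX M K N m := by
  intro z hz
  induction hz using Submodule.span_induction with
  | zero => simp
  | add a b _ _ ha hb => rw [map_add]; exact Submodule.add_mem _ ha hb
  | smul c a _ ha => rw [map_smul]; exact Submodule.smul_mem _ _ ha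
  | mem z hz =>
    obtain ⟨s, x, hs, ⟨i, hi, hi0⟩, hx, rfl⟩ := hz
    have hne : s.Nonempty := ⟨i, hi⟩
    rw [tAll_cls hx (s.max'_mem hne) (fun j hj => s.le_max' j hj)]
    refine Submodule.smul_mem _ _ (mem_relX (s := s.map _) ?_ ?_ (isTyped_rot hx _))
    · rw [Finset.card_map, hs]
    · refine ⟨i, ?_, hi0⟩
      rw [Finset.mem_map_equiv, Equiv.symm_symm]
      have : (finRotate N ^ ((s.max' hne : Fin N) : ℕ)) i = s.max' hne := by
        apply Fin.ext
        rw [val_finRotate_pow, hi0, zero_add, Nat.mod_eq_of_lt (Fin.is_lt _)]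
      rw [this]
      exact s.max'_mem hne

lemma tAll_pow_cls {N : ℕ} {s : Finset (Fin N)} {x : Fin N → EBar M K} (hx : IsTyped s x)
    (c : ℕ) : ∀ i ∈ s, (s.filter (i ≤ ·)).card = c + 1 →
      (tAll M K N ^ (c + 1)) (cls M K x)
        = ((-1 : k) ^ ((i : ℕ) * (N - 1))) •
            cls M K (fun l => x ((finRotate N ^ (i : ℕ)) l)) := by
  induction c with
  | zero =>
    intro i hi hc
    rw [zero_add, pow_one]
    refine tAll_cls hx hi fun j hj => ?_
    by_contra hlt
    have h1 : i ∈ s.filter (i ≤ ·) := by simp [hi]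
    have h2 : j ∈ s.filter (i ≤ ·) := by simp [hj, (not_le.mp hlt).le]
    have := Finset.card_le_one.mp (by rw [hc]) i h1 j h2
    exact hlt this.ge
  | succ c ih =>
    intro i hi hc
    have herase : s.filter (i < ·) = (s.filter (i ≤ ·)).erase i := by
      ext j
      simp only [Finset.mem_filter, Finset.mem_erase, lt_iff_le_and_ne]
      tauto
    have hcard : (s.filter (i < ·)).card = c + 1 := by
      rw [herase, Finset.card_erase_of_mem (by simp [hi]), hc]; rfl
    have hne : (s.filter (i < ·)).Nonempty := by
      rw [← Finset.card_pos, hcard]; omega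
    obtain ⟨i', hi'm, hmin⟩ : ∃ i' ∈ s.filter (i < ·), ∀ j ∈ s.filter (i < ·), i' ≤ j :=
      ⟨_, Finset.min'_mem _ hne, fun j hj => Finset.min'_le _ j hj⟩
    obtain ⟨hi's, hii'⟩ := Finset.mem_filter.mp hi'm
    have hfilter : s.filter (i' ≤ ·) = s.filter (i < ·) := by
      ext j
      simp only [Finset.mem_filter]
      refine ⟨fun h => ⟨h.1, lt_of_lt_of_le hii' h.2⟩, fun h => ⟨h.1, hmin j ?_⟩⟩
      simpa using h
    rw [pow_succ', Module.End.mul_apply, ih i' hi's (by rw [hfilter, hcard]), map_smul]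
    have hlt : (i : ℕ) < i' := hii'
    have hi'N := i'.2
    have hb : N - (i' : ℕ) + i < N := by omega
    have hmem : (⟨N - (i' : ℕ) + i, hb⟩ : Fin N)
        ∈ s.map (finRotate N ^ (i' : ℕ)).symm.toEmbedding := by
      rw [Finset.mem_map_equiv, Equiv.symm_symm]
      have : (finRotate N ^ (i' : ℕ)) ⟨N - (i' : ℕ) + i, hb⟩ = i := by
        apply Fin.ext
        rw [val_finRotate_pow]
        have : N - (i' : ℕ) + i + i' = i + N := by omega
        simp only [this, Nat.add_mod_right]
        exact Nat.mod_eq_of_lt i.2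
      rw [this]; exact hi
    rw [tAll_cls (isTyped_rot hx (finRotate N ^ (i' : ℕ))) hmem]
    · rw [smul_smul, ← pow_add]
      congr 1
      · have hN : (i' : ℕ) * (N - 1) + (N - i' + i) * (N - 1) = N * (N - 1) + i * (N - 1) := by
          rw [← add_mul, ← add_mul]; congr 1; omega
        simp only [hN]
        rw [pow_add, (Nat.even_mul_pred_self N).neg_one_pow, one_mul]
      · congr 1
        funext l
        rw [← Equiv.Perm.mul_apply, ← pow_add]
        have : (i' : ℕ) + (N - i' + i) = N + i := by omega
        simp only [this]
        rw [pow_add, finRotate_pow_self, one_mul]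
    · intro j hj
      rw [Finset.mem_map_equiv, Equiv.symm_symm] at hj
      by_contra hlt'
      have hlt2 : N - (i' : ℕ) + i < j := not_le.mp hlt'
      have hjN := j.2
      have hv : ((finRotate N ^ (i' : ℕ)) j : ℕ) = j + i' - N := by
        rw [val_finRotate_pow, Nat.mod_eq_sub_mod (by omega), Nat.mod_eq_of_lt (by omega)]
      have h1 : i' ≤ (finRotate N ^ (i' : ℕ)) j := by
        apply hmin
        rw [Finset.mem_filter]
        refine ⟨hj, ?_⟩
        rw [Fin.lt_def, hv]; omega
      rw [Fin.le_def, hv] at h1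
      omega

lemma tAll_pow {N m : ℕ} : ∀ z ∈ relX M K N m, (tAll M K N ^ m) z = z := by
  intro z hz
  induction hz using Submodule.span_induction with
  | zero => simp
  | add a b _ _ ha hb => rw [map_add, ha, hb]
  | smul c a _ ha => rw [map_smul, ha]
  | mem z hz =>
    obtain ⟨s, x, hs, ⟨i, hi, hi0⟩, hx, rfl⟩ := hz
    have hf : s.filter (i ≤ ·) = s := by
      apply Finset.filter_true_of_mem
      intro j _
      rw [Fin.le_def, hi0]; exact Nat.zero_le _
    have hpos : 0 < s.card := Finset.card_pos.mpr ⟨i, hi⟩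
    obtain ⟨c, rfl⟩ : ∃ c, m = c + 1 := ⟨m - 1, by omega⟩
    rw [tAll_pow_cls hx c i hi (by rw [hf, hs]), hi0]
    simp

lemma contr_mem_aux {N m : ℕ} (j : Fin N) {s : Finset (Fin (N + 1))}
    {x : Fin (N + 1) → EBar M K} (hx : IsTyped s x) (hs : s.card = m + 1)
    (h0 : j.castSucc ∈ s → ∃ i ∈ s, (i : ℕ) = 0) :
    contr K μ j (cls M K x) ∈ relX M K N m := by
  rw [contr_cls]
  by_cases h : j.castSucc ∈ s ∧ j.succ ∈ s
  · obtain ⟨h1, h2⟩ := h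
    refine mem_relX (s := (s.erase j.succ).image (collapse j)) ?_ ?_ ?_
    · rw [Finset.card_image_of_injOn, Finset.card_erase_of_mem h2, hs]
      · rfl
      · intro a ha b hb hab
        have ha' : (a : ℕ) ≠ j + 1 := fun h => (Finset.mem_erase.mp ha).1 (Fin.ext (by simpa using h))
        have hb' : (b : ℕ) ≠ j + 1 := fun h => (Finset.mem_erase.mp hb).1 (Fin.ext (by simpa using h))
        apply Fin.ext
        unfold collapse at hab
        split_ifs at hab <;> simp only [Fin.mk.injEq] at hab <;> omega
    · obtain ⟨i, hi, hi0⟩ := h0 h1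
      refine ⟨collapse j i, Finset.mem_image_of_mem _ (Finset.mem_erase.mpr ⟨?_, hi⟩), ?_⟩
      · rintro rfl; simp at hi0
      · simp [collapse, hi0]
    · constructor
      · intro l hl
        obtain ⟨i, hi, rfl⟩ := Finset.mem_image.mp hl
        obtain ⟨hij, his⟩ := Finset.mem_erase.mp hi
        rw [← contrFun_slot, contrSlot]
        rw [if_neg hij]
        split_ifs
        · rw [LinearMap.flip_apply, nab_apply]
        · exact hx.1 i his
      · intro l hl
        unfold contrFun
        split_ifs with h3 h4
        · apply hx.2
          intro h5
          refine hl (Finset.mem_image.mpr ⟨_, Finset.mem_erase.mpr ⟨?_, h5⟩, ?_⟩)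
          · intro h6
            have := congrArg Fin.val h6
            rw [Fin.lt_def] at h3
            simp at this; omega
          · rw [Fin.lt_def] at h3
            simp [collapse, h3.le]
        · exfalso
          subst h4
          refine hl (Finset.mem_image.mpr ⟨_, Finset.mem_erase.mpr ⟨?_, h1⟩, ?_⟩)
          · simp [Fin.ext_iff]
          · simp [collapse]
        · apply hx.2
          intro h5
          have h7 : (j : ℕ) < l := by
            rw [Fin.lt_def] at h3
            rw [Fin.ext_iff] at h4
            omega
          refine hl (Finset.mem_image.mpr ⟨_, Finset.mem_erase.mpr ⟨?_, h5⟩, ?_⟩)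
          · intro h6; exact h4 (Fin.succ_injective _ h6)
          · have : ¬ (l : ℕ) + 1 ≤ j := by omega
            simp [collapse, this]
  · rw [cls_eq_zero j]
    · exact Submodule.zero_mem _
    · simp only [contrFun, lt_irrefl, if_false, if_true, nab_apply]
      by_cases h1 : j.castSucc ∈ s
      · have h2 : j.succ ∉ s := fun h2 => h ⟨h1, h2⟩
        rw [hx.2 _ h2]; simp
      · rw [hx.2 _ h1]; simp

lemma rhoAll_mem {n m : ℕ} (j : ℕ) :
    ∀ z ∈ relX M K (n + 1) (m + 1), rhoAll K μ n j z ∈ relX M K n m := by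
  intro z hz
  induction hz using Submodule.span_induction with
  | zero => simp
  | add a b _ _ ha hb => rw [map_add]; exact Submodule.add_mem _ ha hb
  | smul c a _ ha => rw [map_smul]; exact Submodule.smul_mem _ _ ha
  | mem z hz =>
    obtain ⟨s, x, hs, h0, hx, rfl⟩ := hz
    unfold rhoAll
    split_ifs with h1 h2
    · rw [LinearMap.smul_apply]
      exact Submodule.smul_mem _ _ (contr_mem_aux μ _ hx hs fun _ => h0)
    · rw [LinearMap.smul_apply, LinearMap.comp_apply, rot_pow_cls]
      refine Submodule.smul_mem _ _
        (contr_mem_aux μ _ (isTyped_rot hx _) (by rw [Finset.card_map, hs]) fun h => ⟨_, h, rfl⟩)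
    · exact Submodule.zero_mem _

/-! ### The complex and its operators -/

variable (M K)

/-- `X M K v m` is spanned by the classes of the tensors `x_0 ⊗ ⋯ ⊗ x_n` with `x_0 ∈ M`, with
exactly `m` of the `n + 1 = v + m` factors in `M`, and with the other `v` factors in `A / K`.
Thus `X_{v,w}` is `X M K v (w + 1)` and `X_{v,w-1}` is `X M K v w`, for every `w ≥ 0`; in
particular `X_{v,-1}`, that is `X M K v 0`, is the zero module. -/
abbrev X (v m : ℕ) : Type _ := ↥(relX M K (v + m) m)

/-- The operator `t` on `X`. -/
def t (v m : ℕ) : Module.End k (X M K v m) := (tAll M K (v + m)).restrict tAll_mem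

/-- `N = 1 + t + ⋯ + t^w` on `X_{v,w}`, where `m = w + 1`. -/
def Nm (v m : ℕ) : Module.End k (X M K v m) := ∑ l ∈ Finset.range m, t M K v m ^ l

variable {M}

/-- `ϱ_j : X_{v,w} → X_{v,w-1}`. -/
def rho (v w j : ℕ) : X M K v (w + 1) →ₗ[k] X M K v w :=
  (rhoAll K μ (v + w) j).restrict (rhoAll_mem μ j)

/-- `d' = ∑_{j < n} ϱ_j : X_{v,w} → X_{v,w-1}`, where `n = v + w`. -/
def d' (v w : ℕ) : X M K v (w + 1) →ₗ[k] X M K v w :=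
  ∑ j ∈ Finset.range (v + w), rho K μ v w j

/-- `d = d' + ϱ_n : X_{v,w} → X_{v,w-1}`, where `n = v + w`. -/
def d (v w : ℕ) : X M K v (w + 1) →ₗ[k] X M K v w := d' K μ v w + rho K μ v w (v + w)

variable (M)

/-- `Ẍ_{v,w} = X_{v,w} ⊕ X_{v,w-1}`. -/
abbrev XDD (v w : ℕ) : Type _ := X M K v (w + 1) × X M K v w

variable {M}

/-- The Karoubi operator `κ(x, y) = (t x, t y + d' x - d x)` of `Ẍ_{v,w}`. -/
def karoubi (v w : ℕ) : Module.End k (XDD M K v w) :=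
  LinearMap.prodMap (t M K v (w + 1)) (t M K v w)
    + (LinearMap.inr k _ _).comp ((d' K μ v w - d K μ v w).comp (LinearMap.fst k _ _))

/-- The generalized eigenspace `ker (κ - 1)²`. -/
def harmonicSub (v w : ℕ) : Submodule k (XDD M K v w) :=
  LinearMap.ker ((karoubi K μ v w - 1) ^ 2)

/-- Its complement `im (κ - 1)²`. -/
def antiharmonicSub (v w : ℕ) : Submodule k (XDD M K v w) :=
  LinearMap.range ((karoubi K μ v w - 1) ^ 2)

variable (M)

/-- `X̄_{v,w}`, the cokernel of `1 - t` on `X_{v,w}`; here `m = w + 1` as in `X`. -/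
abbrev XBar (v m : ℕ) : Type _ := X M K v m ⧸ LinearMap.range (1 - t M K v m)

/-- `X̃_{v,w} = X̄_{v,w} ⊕ X̄_{v,w-1}`. -/
abbrev XTilde (v w : ℕ) : Type _ := XBar M K v (w + 1) × XBar M K v w

/-- The class `[x]` of `x` in the cokernel of `1 - t`. -/
def brk (v m : ℕ) : X M K v m →ₗ[k] XBar M K v m :=
  (LinearMap.range (1 - t M K v m)).mkQ

lemma t_pow (v m : ℕ) : t M K v m ^ m = 1 := by
  apply LinearMap.ext
  intro x
  apply Subtype.ext
  have h : ∀ (l : ℕ), (((t M K v m ^ l) x : X M K v m) : CycT M K (v + m))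
      = (tAll M K (v + m) ^ l) x := by
    intro l
    induction l with
    | zero => simp
    | succ l ih =>
      rw [pow_succ', pow_succ', Module.End.mul_apply, Module.End.mul_apply, ← ih]
      rfl
  rw [h]
  exact tAll_pow _ x.2

lemma Nm_comp_sub (v m : ℕ) : Nm M K v m * (1 - t M K v m) = 0 := by
  have := geom_sum_mul_neg (t M K v m) m
  rw [Nm, this, t_pow, sub_self]

/-- The map `N̄ : X̄_{v,w} → X_{v,w}` induced by `N`. -/
def NBar (v m : ℕ) : XBar M K v m →ₗ[k] X M K v m :=
  (LinearMap.range (1 - t M K v m)).liftQ (Nm M K v m) (by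
    rintro _ ⟨x, rfl⟩
    exact LinearMap.congr_fun (Nm_comp_sub M K v m) x)

variable [Algebra ℚ k]

/-- `𝔭(x) = [x] / (w + 1)` on `X_{v,w}`, where `m = w + 1`. -/
def pMap (v m : ℕ) : X M K v m →ₗ[k] XBar M K v m :=
  algebraMap ℚ k (1 / (m : ℚ)) • brk M K v m

/-- `σ' = ∑_{j < w} (w - j) / (w + 1) t^j` on `X_{v,w}`, where `m = w + 1`. -/
def sigma' (v m : ℕ) : Module.End k (X M K v m) :=
  ∑ j ∈ Finset.range (m - 1), algebraMap ℚ k (((m : ℚ) - 1 - j) / m) • t M K v m ^ j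

variable {M}

/-- `Υ = (-1 + N̄ 𝔭) σ' d : X_{v,w} → X_{v,w-1}`; it is `0` for `w = 0`, its codomain being zero. -/
def upsilon (v w : ℕ) : X M K v (w + 1) →ₗ[k] X M K v w :=
  (-1 + NBar M K v w ∘ₗ pMap M K v w) ∘ₗ sigma' M K v w ∘ₗ d K μ v w

/-- `Ψ(x, y) = (N̄ x, Υ N̄ x) / (w + 1) + (0, N̄ y)` on `X̃_{v,w}`. -/
def Psi (v w : ℕ) : XTilde M K v w →ₗ[k] XDD M K v w :=
  algebraMap ℚ k (1 / ((w : ℚ) + 1)) •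
      ((LinearMap.prod (NBar M K v (w + 1)) (upsilon K μ v w ∘ₗ NBar M K v (w + 1))) ∘ₗ
        LinearMap.fst k _ _)
    + (LinearMap.inr k _ _) ∘ₗ NBar M K v w ∘ₗ LinearMap.snd k _ _

end

end CleftExt

/-! ### Cyclic combinatorics: each `ϱ_j` in terms of `ϱ_n` and `t` -/

namespace CleftExt
section
variable {k A : Type*} {M : Type*} [CommRing k] [Ring A] [Algebra k A]
  [AddCommGroup M] [Module k M] [Module A M] [Module Aᵐᵒᵖ M] [IsScalarTower k A M]
  [IsScalarTower k Aᵐᵒᵖ M] {K : Subalgebra k A} (μ : AssocBimoduleMap k A M)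

/-! Since `d' - d = -ϱ_n`, the operator `κ - 1` is triangular: `(a, b) ↦ ((t - 1) a, (t - 1) b - ϱ_n
a)`. On `X_{v,w}` one has `t^(w+1) = 1`, and on `X_{v,w-1}` one has `t^w = 1`. As `ℚ ⊆ k`, the
average `E` (resp. `e`) of the powers of `t` projects onto the invariants, and `σ'` inverts `1 - t`
up to that projection.

These facts alone determine both subspaces: `(a, b)` lies in `ker (κ - 1)²` iff `a` is invariant and
`(t - 1) b = (1 - e) ϱ_n a`, and in `im (κ - 1)²` iff `E a = 0` and `e b = e ϱ_n σ' a`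
(`mem_ker_sq_iff`, `mem_range_sq_iff`). If `U` satisfies `e U = 0` and `(t - 1) U a = (1 - e) ϱ_n a`
on invariants, then the kernel consists of the pairs with `a` and `b - U a` both invariant, and the
component of `(x, y)` in the kernel is explicit (`sub_mem_range_sq`).

That `U = Υ` is such a map needs one fact about tensors. A nonzero `ϱ_j` with `j < n` equals `t^(-c)
ϱ_n t^c`, where `c` counts the factors in `M` from position `j + 1` on. Hence `d' = ∑_{c=1}^{w}
t^(w-c) ϱ_n t^c` (`sum_rhoAll`), so `d = N ϱ_n + ϱ_n` on invariants, and `(1 - e) d = (1 - e) ϱ_n`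
there (`t_upsilon_sub`). The coefficients of `P̃` are those of `(1 - E) σ'` (`averageHomotopy_sub`),
multiplied by `-1/w`. -/

/-- The positions of the factors in `M` after the factors `j` and `j + 1` were multiplied. -/
def contrType {N : ℕ} (j : Fin N) (s : Finset (Fin (N + 1))) : Finset (Fin N) :=
  Finset.univ.filter fun l => (if l < j then l.castSucc else l.succ) ∈ s

/-- The merged position counts as an `M`-position even if `x_j ∈ A / K`: its entry is then `0`. So
no case distinction on `x_j` is needed later. -/
lemma isTyped_contrFun {N : ℕ} {s : Finset (Fin (N + 1))} {x : Fin (N + 1) → EBar M K}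
    (hx : IsTyped s x) (j : Fin N) (h : j.succ ∈ s) :
    IsTyped (contrType j s) (contrFun μ j x) := by
  constructor
  · intro l hl
    simp only [contrType, Finset.mem_filter, Finset.mem_univ, true_and] at hl
    unfold contrFun
    split_ifs at hl ⊢ with h1 h2
    · exact hx.1 _ hl
    · rw [nab_apply]
    · exact hx.1 _ hl
  · intro l hl
    simp only [contrType, Finset.mem_filter, Finset.mem_univ, true_and] at hl
    unfold contrFun
    split_ifs at hl ⊢ with h1 h2
    · exact hx.2 _ hl
    · exact absurd (h2 ▸ h) hl
    · exact hx.2 _ hl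

/-- Makes the same power of `t` bring `x_{j+1}` to the front before the contraction and the merged
factor to the front after it. -/
lemma card_filter_contrType {N : ℕ} (s : Finset (Fin (N + 1))) (j : Fin N) :
    ((contrType j s).filter (j ≤ ·)).card = (s.filter (j.succ ≤ ·)).card := by
  rw [← Finset.card_map (Fin.succEmb N)]
  congr 1
  ext i
  simp only [contrType, Finset.mem_map, Finset.mem_filter, Finset.mem_univ, true_and,
    Fin.coe_succEmb]
  constructor
  · rintro ⟨l, ⟨h1, h2⟩, rfl⟩
    rw [if_neg (not_lt.mpr h2)] at h1
    exact ⟨h1, Fin.succ_le_succ_iff.mpr h2⟩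
  · rintro ⟨h1, h2⟩
    have hi : i ≠ 0 := by
      rintro rfl
      exact absurd h2 (by simp)
    obtain ⟨l, rfl⟩ := Fin.exists_succ_eq.mpr hi
    have h3 := Fin.succ_le_succ_iff.mp h2
    exact ⟨l, ⟨by rwa [if_neg (not_lt.mpr h3)], h3⟩, rfl⟩

lemma contrFun_rotate {N : ℕ} (hN : 0 < N) (j : Fin N) (x : Fin (N + 1) → EBar M K) :
    contrFun μ ⟨0, hN⟩ (fun l => x ((finRotate (N + 1) ^ (j : ℕ)) l))
      = fun l => contrFun μ j x ((finRotate N ^ (j : ℕ)) l) := by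
  have hj := j.2
  funext l
  have hl := l.2
  have hr : ∀ (i : Fin (N + 1)) (a : Fin (N + 1)),
      (a : ℕ) = (i + j) % (N + 1) → (finRotate (N + 1) ^ (j : ℕ)) i = a := by
    intro i a h
    exact Fin.ext (by rw [val_finRotate_pow, h])
  have hv := val_finRotate_pow (N := N) j l
  set p := (finRotate N ^ (j : ℕ)) l with hp
  unfold contrFun
  by_cases h0 : (l : ℕ) = 0
  · have hl0 : l = ⟨0, hN⟩ := Fin.ext h0
    have hpj : p = j := by
      apply Fin.ext
      rw [hv, h0, zero_add, Nat.mod_eq_of_lt hj]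
    rw [hpj, if_neg (by rw [hl0]; exact lt_irrefl _), if_pos hl0, if_neg (lt_irrefl _), if_pos rfl]
    congr 2
    · refine congrArg x (hr _ j.castSucc ?_)
      simp [Nat.mod_eq_of_lt (show (j : ℕ) < N + 1 by omega)]
    · refine congrArg x (hr _ j.succ ?_)
      simp only [Fin.val_succ, zero_add]
      rw [Nat.mod_eq_of_lt (by omega)]; omega
  · rw [if_neg (by rw [Fin.lt_def]; simp), if_neg (by rw [Fin.ext_iff]; exact h0)]
    by_cases hlt : (l : ℕ) + j < N
    · rw [Nat.mod_eq_of_lt hlt] at hv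
      rw [if_neg (by rw [Fin.lt_def]; omega), if_neg (by rw [Fin.ext_iff]; omega)]
      refine congrArg x (hr _ _ ?_)
      simp only [Fin.val_succ]
      rw [Nat.mod_eq_of_lt (by omega)]; omega
    · rw [Nat.mod_eq_sub_mod (by omega), Nat.mod_eq_of_lt (by omega)] at hv
      rw [if_pos (by rw [Fin.lt_def]; omega)]
      refine congrArg x (hr _ _ ?_)
      simp only [Fin.val_succ, Fin.val_castSucc]
      rw [Nat.mod_eq_sub_mod (by omega), Nat.mod_eq_of_lt (by omega)]; omega

/-- The power of `t` on the left brings `x_{j+1}` to the front and so `x_j` to the end, where `ϱ_n`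
multiplies the two. On the right the product is formed in place and then brought to the front. -/
lemma rhoAll_tAll_pow_cls {n : ℕ} {s : Finset (Fin (n + 1))} {x : Fin (n + 1) → EBar M K}
    (hx : IsTyped s x) (j : Fin n) (hj : j.succ ∈ s) :
    rhoAll K μ n n ((tAll M K (n + 1) ^ (s.filter (j.succ ≤ ·)).card) (cls M K x))
      = (tAll M K n ^ (s.filter (j.succ ≤ ·)).card) (rhoAll K μ n j (cls M K x)) := by
  have hn : 0 < n := j.pos
  obtain ⟨c, hc⟩ : ∃ c, (s.filter (j.succ ≤ ·)).card = c + 1 := by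
    have : 0 < (s.filter (j.succ ≤ ·)).card :=
      Finset.card_pos.mpr ⟨_, Finset.mem_filter.mpr ⟨hj, le_rfl⟩⟩
    exact ⟨_, (Nat.sub_add_cancel this).symm⟩
  have h1 : rhoAll K μ n n = ((-1 : k) ^ n) • (contr K μ ⟨0, hn⟩ ∘ₗ (rot M K (n + 1) ^ n)) := by
    rw [rhoAll, dif_neg (lt_irrefl n), dif_pos hn]
  have h2 : rhoAll K μ n j = ((-1 : k) ^ (j : ℕ)) • contr K μ j := by
    rw [rhoAll, dif_pos j.2]
  rw [hc, tAll_pow_cls hx c _ hj hc, h1, h2, map_smul, LinearMap.smul_apply, LinearMap.comp_apply,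
    rot_pow_cls, contr_cls, LinearMap.smul_apply, contr_cls, map_smul,
    tAll_pow_cls (isTyped_contrFun μ hx j hj) c j
      (by simpa [contrType] using hj) (by rw [card_filter_contrType, hc])]
  -- The `n`-fold rotation inside `ϱ_n` undoes one step: `(j + 1) + n ≡ j` modulo `n + 1`.
  have h3 : (fun l => x ((finRotate (n + 1) ^ ((j.succ : Fin (n + 1)) : ℕ))
      ((finRotate (n + 1) ^ n) l))) = fun l => x ((finRotate (n + 1) ^ (j : ℕ)) l) := by
    funext l
    rw [← Equiv.Perm.mul_apply, ← pow_add]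
    have : ((j.succ : Fin (n + 1)) : ℕ) + n = j + (n + 1) := by simp; omega
    rw [this, pow_add, finRotate_pow_self, mul_one]
  rw [h3, contrFun_rotate μ hn, smul_smul, smul_smul, ← pow_add, ← pow_add]
  congr 1
  -- Both signs are `(-1)^(j n)`: the exponents are `(j + 1) n + n` and `j (n - 1) + j`.
  apply neg_one_pow_congr
  obtain ⟨m, rfl⟩ : ∃ m, n = m + 1 := ⟨n - 1, by omega⟩
  simp only [Fin.val_succ, Nat.add_sub_cancel]
  simp only [Nat.even_add, Nat.even_mul, Nat.not_even_one]
  tauto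

lemma rhoAll_cls_eq_zero {n : ℕ} {s : Finset (Fin (n + 1))} {x : Fin (n + 1) → EBar M K}
    (hx : IsTyped s x) (j : Fin n) (hj : j.succ ∉ s) : rhoAll K μ n j (cls M K x) = 0 := by
  rw [rhoAll, dif_pos j.2, LinearMap.smul_apply, contr_cls, cls_eq_zero j, smul_zero]
  simp only [contrFun, lt_irrefl, if_false, if_true, nab_apply]
  rw [hx.2 _ hj]; simp

/-- On a typed tensor only the `j` with `x_{j+1} ∈ M` contribute. There are `w` of them since `x_0 ∈
M`, and the number of `M`-factors from `j + 1` on decreases strictly in `j`, so it takes each value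
`1, …, w` once. -/
lemma sum_rhoAll {n w : ℕ} : ∀ z ∈ relX M K (n + 1) (w + 1),
    ∑ j ∈ Finset.range n, rhoAll K μ n j z
      = ∑ c ∈ Finset.Icc 1 w,
        (tAll M K n ^ (w - c)) (rhoAll K μ n n ((tAll M K (n + 1) ^ c) z)) := by
  intro z hz
  induction hz using Submodule.span_induction with
  | zero => simp
  | add a b _ _ ha hb => simp only [map_add, Finset.sum_add_distrib, ha, hb]
  | smul c a _ ha => simp only [map_smul, ← Finset.smul_sum, ha]
  | mem z hz =>
    obtain ⟨s, x, hs, h0, hx, rfl⟩ := hz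
    have h0' : (0 : Fin (n + 1)) ∈ s := by
      obtain ⟨i, hi, hi0⟩ := h0
      rwa [show (0 : Fin (n + 1)) = i from Fin.ext hi0.symm]
    set S : Finset (Fin n) := Finset.univ.filter fun j => j.succ ∈ s with hS
    have hmem : ∀ j, j ∈ S ↔ j.succ ∈ s := fun j => by simp [hS]
    have hcardS : S.card = w := by
      have : S.map (Fin.succEmb n) = s.erase 0 := by
        ext i
        simp only [Finset.mem_map, hmem, Fin.coe_succEmb, Finset.mem_erase]
        constructor
        · rintro ⟨l, h, rfl⟩
          exact ⟨Fin.succ_ne_zero l, h⟩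
        · rintro ⟨h1, h2⟩
          obtain ⟨l, rfl⟩ := Fin.exists_succ_eq.mpr h1
          exact ⟨l, h2, rfl⟩
      rw [← Finset.card_map (Fin.succEmb n), this, Finset.card_erase_of_mem h0', hs]; rfl
    rw [Finset.sum_range (fun j => rhoAll K μ n j (cls M K x)),
      ← Finset.sum_subset (Finset.subset_univ S) fun j _ hj =>
        rhoAll_cls_eq_zero μ hx j (mt (hmem j).mpr hj)]
    have hmaps : ∀ j ∈ S, (s.filter (j.succ ≤ ·)).card ∈ Finset.Icc 1 w := by
      intro j hj
      rw [hmem] at hj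
      rw [Finset.mem_Icc]
      refine ⟨Finset.card_pos.mpr ⟨_, Finset.mem_filter.mpr ⟨hj, le_rfl⟩⟩, ?_⟩
      have : (s.filter (j.succ ≤ ·)).card < s.card := by
        apply Finset.card_lt_card
        rw [Finset.filter_ssubset]
        exact ⟨0, h0', by simp⟩
      omega
    have hlt : ∀ j ∈ S, ∀ j', j < j' →
        (s.filter (j'.succ ≤ ·)).card < (s.filter (j.succ ≤ ·)).card := by
      intro j hj j' hjj
      rw [hmem] at hj
      apply Finset.card_lt_card
      rw [Finset.ssubset_iff_of_subset]
      · exact ⟨j.succ, Finset.mem_filter.mpr ⟨hj, le_rfl⟩, fun h =>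
          absurd (Fin.succ_le_succ_iff.mp (Finset.mem_filter.mp h).2) (not_le.mpr hjj)⟩
      · intro i hi
        rw [Finset.mem_filter] at hi ⊢
        exact ⟨hi.1, (Fin.succ_le_succ_iff.mpr hjj.le).trans hi.2⟩
    have hinj : Set.InjOn (fun j : Fin n => (s.filter (j.succ ≤ ·)).card) S := by
      intro a ha b hb hab
      rcases lt_trichotomy a b with h | h | h
      · exact absurd hab (hlt a ha b h).ne'
      · exact h
      · exact absurd hab (hlt b hb a h).ne
    refine Finset.sum_nbij (fun j => (s.filter (j.succ ≤ ·)).card) hmaps hinj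
      (Finset.surjOn_of_injOn_of_card_le _ hmaps hinj (by simp [hcardS])) ?_
    intro j hj
    -- After the contraction `w` factors in `M` remain, so `t^(w-c) t^c = t^w = 1`.
    rw [rhoAll_tAll_pow_cls μ hx j ((hmem j).mp hj), ← Module.End.mul_apply, ← pow_add,
      Nat.sub_add_cancel (Finset.mem_Icc.mp (hmaps j hj)).2,
      tAll_pow _ (rhoAll_mem μ j _ (mem_relX hs h0 hx))]

lemma coe_t_pow (v m l : ℕ) (x : X M K v m) :
    (((t M K v m ^ l) x : X M K v m) : CycT M K (v + m)) = (tAll M K (v + m) ^ l) x := by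
  induction l with
  | zero => simp
  | succ l ih =>
    rw [pow_succ', pow_succ', Module.End.mul_apply, Module.End.mul_apply, ← ih]
    rfl

lemma d'_apply (v w : ℕ) (x : X M K v (w + 1)) :
    d' K μ v w x = ∑ c ∈ Finset.Icc 1 w,
      (t M K v w ^ (w - c)) (rho K μ v w (v + w) ((t M K v (w + 1) ^ c) x)) := by
  apply Subtype.ext
  have h := sum_rhoAll μ (n := v + w) x.1 x.2
  rw [d', LinearMap.sum_apply, Submodule.coe_sum, Submodule.coe_sum]
  refine Eq.trans ?_ (h.trans ?_)
  · rfl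
  · refine Finset.sum_congr rfl fun c _ => ?_
    rw [coe_t_pow]
    congr 1
    exact congrArg _ (coe_t_pow v (w + 1) c x).symm

/-- On the invariants of `t`, the operators `d` and `N ϱ_n + ϱ_n` agree. -/
lemma d_apply_of_fixed (v w : ℕ) (x : X M K v (w + 1)) (hx : t M K v (w + 1) x = x) :
    d K μ v w x = Nm M K v w (rho K μ v w (v + w) x) + rho K μ v w (v + w) x := by
  have hp : ∀ c : ℕ, (t M K v (w + 1) ^ c) x = x := by
    intro c
    induction c with
    | zero => simp
    | succ c ih => rw [pow_succ, Module.End.mul_apply, hx, ih]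
  rw [d, LinearMap.add_apply, d'_apply, Nm, LinearMap.sum_apply]
  congr 1
  refine Finset.sum_nbij' (fun c => w - c) (fun c => w - c) ?_ ?_ ?_ ?_ ?_
  · intro c hc; simp only [Finset.mem_Icc, Finset.mem_range] at *; omega
  · intro c hc; simp only [Finset.mem_Icc, Finset.mem_range] at *; omega
  · intro c hc; simp only [Finset.mem_Icc] at *; omega
  · intro c hc; simp only [Finset.mem_range] at *; omega
  · intro c _; rw [hp]

/-- Settles `w = 0`, where the averages over `X_{v,-1}` involve `1 / 0 = 0`. -/
lemma subsingleton_X_zero (v : ℕ) : Subsingleton (X M K v 0) := by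
  have : relX M K (v + 0) 0 = ⊥ := by
    rw [relX, Submodule.span_eq_bot]
    rintro _ ⟨s, x, hs, ⟨i, hi, -⟩, -⟩
    rw [Finset.card_eq_zero.mp hs] at hi
    exact absurd hi (Finset.notMem_empty i)
  rw [X, this]
  infer_instance
end
end CleftExt

/-! ### Averages over operators of finite order -/

namespace CleftExt
section Averaging

/-- `E` is the projection onto the invariants of `T` along the image of `1 - T`, and `σ` inverts
`1 - T` up to `E`. -/
structure IsAverage {R : Type*} [Ring R] (T E σ : R) : Prop where
  mul_left : T * E = E
  mul_right : E * T = E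
  homotopy : (1 - T) * σ = 1 - E
  comm : Commute T σ
  comm' : Commute E σ

section Cyclic

variable {k R : Type*} [CommRing k] [Algebra ℚ k] [Ring R] [Algebra k R]

/-- `(1 + T + ⋯ + T ^ (m - 1)) / m` -/
def average (k : Type*) {R : Type*} [CommRing k] [Algebra ℚ k] [Ring R] [Algebra k R]
    (T : R) (m : ℕ) : R :=
  algebraMap ℚ k (1 / (m : ℚ)) • ∑ l ∈ Finset.range m, T ^ l

/-- `∑_{j < m - 1} (m - 1 - j) / m T ^ j` -/
def averageHomotopy (k : Type*) {R : Type*} [CommRing k] [Algebra ℚ k] [Ring R] [Algebra k R]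
    (T : R) (m : ℕ) : R :=
  ∑ j ∈ Finset.range (m - 1), algebraMap ℚ k (((m : ℚ) - 1 - j) / m) • T ^ j

/-- Telescoping: consecutive coefficients differ by `1 / q`. Keeping `q` independent of `p` allows
induction on `p`; the boundary term vanishes for `q = m`, `p = m - 1`. -/
lemma one_sub_mul_sum_pow (T : R) {q : ℚ} (hq : q ≠ 0) (p : ℕ) :
    (1 - T) * ∑ j ∈ Finset.range p, algebraMap ℚ k ((q - 1 - j) / q) • T ^ j
      = 1 - algebraMap ℚ k (1 / q) • ∑ l ∈ Finset.range (p + 1), T ^ l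
        - algebraMap ℚ k ((q - 1 - p) / q) • T ^ p := by
  induction p with
  | zero =>
    simp only [Finset.range_zero, Finset.sum_empty, mul_zero, zero_add, Finset.sum_range_one,
      pow_zero, Nat.cast_zero, sub_zero]
    rw [sub_sub, ← add_smul, ← map_add, ← add_div, add_sub_cancel, div_self hq, map_one, one_smul,
      sub_self]
  | succ p ih =>
    rw [Finset.sum_range_succ, mul_add, ih, Finset.sum_range_succ _ (p + 1), smul_add,
      mul_smul_comm, sub_mul, one_mul, ← pow_succ']
    have h : (q - 1 - p) / q = 1 / q + (q - 1 - ((p + 1 : ℕ) : ℚ)) / q := by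
      push_cast; rw [← add_div]; congr 1; ring
    have h2 : algebraMap ℚ k ((q - 1 - p) / q) • T ^ (p + 1)
        = algebraMap ℚ k (1 / q) • T ^ (p + 1)
          + algebraMap ℚ k ((q - 1 - ((p + 1 : ℕ) : ℚ)) / q) • T ^ (p + 1) := by
      rw [← add_smul, ← map_add, ← h]
    rw [smul_sub, h2]
    abel

lemma isAverage_average {T : R} {m : ℕ} (hm : 0 < m) (hT : T ^ m = 1) :
    IsAverage T (average k T m) (averageHomotopy k T m) := by
  have hN : (1 - T) * ∑ l ∈ Finset.range m, T ^ l = 0 := by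
    rw [mul_neg_geom_sum, hT, sub_self]
  have hN' : (∑ l ∈ Finset.range m, T ^ l) * (1 - T) = 0 := by
    rw [geom_sum_mul_neg, hT, sub_self]
  have hc : ∀ a : R, Commute T a → Commute a (averageHomotopy k T m) := fun a ha =>
    Commute.sum_right _ _ _ fun j _ => (ha.symm.pow_right j).smul_right _
  refine ⟨?_, ?_, ?_, hc _ (Commute.refl T), hc _ ?_⟩
  · rw [sub_mul, one_mul, sub_eq_zero] at hN
    rw [average, mul_smul_comm, ← hN]
  · rw [mul_sub, mul_one, sub_eq_zero] at hN'
    rw [average, smul_mul_assoc, ← hN']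
  · have h := one_sub_mul_sum_pow (k := k) T (q := m) (by exact_mod_cast hm.ne') (m - 1)
    rw [averageHomotopy, h, average, Nat.sub_add_cancel hm, Nat.cast_sub hm]
    simp
  · exact (Commute.sum_right _ _ _ fun j _ => (Commute.refl T).pow_right j).smul_right _

lemma average_mul_pow {T : R} {m : ℕ} (hm : 0 < m) (hT : T ^ m = 1) (j : ℕ) :
    average k T m * T ^ j = average k T m := by
  induction j with
  | zero => simp
  | succ j ih => rw [pow_succ, ← mul_assoc, ih, (isAverage_average hm hT).mul_right]

lemma averageHomotopy_eq_sum_range (T : R) (m : ℕ) :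
    averageHomotopy k T m
      = ∑ j ∈ Finset.range m, algebraMap ℚ k (((m : ℚ) - 1 - j) / m) • T ^ j := by
  cases m with
  | zero => rfl
  | succ m => simp [averageHomotopy, Finset.sum_range_succ]

lemma sum_range_sub (q : ℚ) (m : ℕ) :
    ∑ j ∈ Finset.range m, (q - 1 - j) = m * (q - 1) - m * ((m : ℚ) - 1) / 2 := by
  induction m with
  | zero => simp
  | succ m ih => rw [Finset.sum_range_succ, ih]; push_cast; ring

lemma sum_range_sub_div {m : ℕ} (hm : 0 < m) :
    ∑ j ∈ Finset.range m, ((m : ℚ) - 1 - j) / m = ((m : ℚ) - 1) / 2 := by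
  have hm' : (m : ℚ) ≠ 0 := by exact_mod_cast hm.ne'
  rw [← Finset.sum_div, sum_range_sub]
  field_simp
  ring

/-- As `E T^j = E`, the product `E σ` is `E` times the sum `(m - 1) / 2` of the coefficients of `σ`.
Subtracting it centres those coefficients. -/
lemma averageHomotopy_sub {T : R} {m : ℕ} (hm : 0 < m) (hT : T ^ m = 1) :
    averageHomotopy k T m - average k T m * averageHomotopy k T m
      = ∑ j ∈ Finset.range m, algebraMap ℚ k (((m : ℚ) - 1 - 2 * j) / (2 * m)) • T ^ j := by
  have hm' : (m : ℚ) ≠ 0 := by exact_mod_cast hm.ne'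
  have h : average k T m * averageHomotopy k T m
      = ∑ j ∈ Finset.range m, algebraMap ℚ k (((m : ℚ) - 1) / (2 * m)) • T ^ j := by
    rw [averageHomotopy_eq_sum_range, Finset.mul_sum]
    simp only [mul_smul_comm, average_mul_pow hm hT]
    rw [← Finset.sum_smul, ← map_sum, sum_range_sub_div hm, average, smul_smul, ← map_mul,
      Finset.smul_sum]
    congr! 3
    field_simp
  rw [h, averageHomotopy_eq_sum_range, ← Finset.sum_sub_distrib]
  refine Finset.sum_congr rfl fun j _ => ?_
  rw [← sub_smul, ← map_sub]
  congr 2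
  field_simp
  ring

end Cyclic

variable {k V W : Type*} [CommRing k] [AddCommGroup V] [Module k V] [AddCommGroup W] [Module k W]

namespace IsAverage

variable {T E σ : Module.End k V} (h : IsAverage T E σ)
include h

lemma apply_left (a : V) : T (E a) = E a := LinearMap.congr_fun h.mul_left a

lemma apply_right (a : V) : E (T a) = E a := LinearMap.congr_fun h.mul_right a

lemma sub_apply (a : V) : σ a - T (σ a) = a - E a := LinearMap.congr_fun h.homotopy a

lemma comm_apply (a : V) : T (σ a) = σ (T a) := LinearMap.congr_fun h.comm a

lemma comm'_apply (a : V) : E (σ a) = σ (E a) := LinearMap.congr_fun h.comm' a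

lemma apply_of_fixed {a : V} (ha : T a = a) : E a = a := by
  have := h.sub_apply a
  rw [h.comm_apply, ha, sub_self] at this
  exact (sub_eq_zero.mp this.symm).symm

lemma idem (a : V) : E (E a) = E a := h.apply_of_fixed (h.apply_left a)

/-- `T` has no Jordan block at `1`: the vector `T a - a` is invariant, hence equal to its average,
which is `0`. -/
lemma fixed_of_sq {a : V} (ha : T (T a - a) = T a - a) : T a = a := by
  have := h.apply_of_fixed ha
  rw [map_sub, h.apply_right, sub_self] at this
  exact sub_eq_zero.mp this.symm

end IsAverage

/-! ### Kernel and image of the square of a triangular operator -/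

section Triangular

variable {T E σ : Module.End k V} {S e τ : Module.End k W} (hT : IsAverage T E σ)
  (hS : IsAverage S e τ) {ρ : V →ₗ[k] W} {κ : Module.End k (V × W)}
  (hκ : ∀ a b, (κ - 1) (a, b) = (T a - a, S b - b - ρ a))
include hT hS hκ

/-- Once `a` is fixed, the second condition says that `S b - b - ρ a` is `S`-invariant; its average
is `-e (ρ a)`, since `e` kills `S b - b`. -/
lemma mem_ker_sq_iff (a : V) (b : W) :
    (a, b) ∈ LinearMap.ker ((κ - 1) ^ 2) ↔ T a = a ∧ S b - b = ρ a - e (ρ a) := by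
  rw [LinearMap.mem_ker, sq, Module.End.mul_apply, hκ, hκ, Prod.mk_eq_zero]
  dsimp only
  constructor
  · rintro ⟨h1, h2⟩
    have ha := hT.fixed_of_sq (sub_eq_zero.mp h1)
    rw [ha, sub_self, map_zero, sub_zero, sub_eq_zero] at h2
    have h3 := hS.apply_of_fixed h2
    rw [map_sub, map_sub, hS.apply_right, sub_self, zero_sub] at h3
    refine ⟨ha, ?_⟩
    rw [← sub_add_cancel (S b - b) (ρ a), ← h3]
    abel
  · rintro ⟨ha, hb⟩
    refine ⟨by rw [ha, sub_self, map_zero, sub_zero], ?_⟩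
    have : S b - b - ρ a = - e (ρ a) := by rw [hb]; abel
    rw [this, ha, sub_self, map_zero, sub_zero, map_neg, hS.apply_left, sub_self]

lemma mem_range_sq_iff (a : V) (b : W) :
    (a, b) ∈ LinearMap.range ((κ - 1) ^ 2) ↔ E a = 0 ∧ e b = e (ρ (σ a)) := by
  have hsq : ∀ (a : V) (b : W), ((κ - 1) ^ 2 : Module.End k (V × W)) (a, b) = (T (T a - a) - (T a - a),
      S (S b - b - ρ a) - (S b - b - ρ a) - ρ (T a - a)) := by
    intro a b
    rw [sq, Module.End.mul_apply, hκ, hκ]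
  constructor
  · rintro ⟨⟨a', b'⟩, h⟩
    rw [hsq, Prod.mk.injEq] at h
    obtain ⟨rfl, rfl⟩ := h
    have h1 : σ (T (T a' - a') - (T a' - a')) = -(T a' - a') := by
      have h2 := hT.sub_apply (T a' - a')
      rw [hT.comm_apply, map_sub E, hT.apply_right, sub_self, sub_zero] at h2
      rw [map_sub, ← neg_sub, h2]
    refine ⟨by rw [map_sub, hT.apply_right, sub_self], ?_⟩
    rw [h1, map_neg, map_neg, map_sub e, map_sub e, hS.apply_right, sub_self, zero_sub]
  · rintro ⟨ha, hb⟩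
    have h1 : T (σ (σ a)) - σ (σ a) = - σ a := by
      have := hT.sub_apply (σ a)
      rw [hT.comm'_apply, ha, map_zero, sub_zero] at this
      rw [← neg_sub, this]
    have h2 : T (σ a) - σ a = - a := by
      have := hT.sub_apply a
      rw [ha, sub_zero] at this
      rw [← neg_sub, this]
    set g : W := b + (S (ρ (σ (σ a))) - ρ (σ (σ a))) - ρ (σ a) with hg
    have hge : e g = 0 := by
      rw [hg, map_sub, map_add, map_sub, hS.apply_right, hb, sub_self, add_zero, sub_self]
    have h3 : S (τ g) - τ g = - g := by
      have := hS.sub_apply g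
      rw [hge, sub_zero] at this
      rw [← neg_sub, this]
    have h4 : S (τ (τ g)) - τ (τ g) = - τ g := by
      have := hS.sub_apply (τ g)
      rw [hS.comm'_apply, hge, map_zero, sub_zero] at this
      rw [← neg_sub, this]
    refine ⟨(σ (σ a), τ (τ g)), ?_⟩
    rw [hsq, h1, h4, Prod.mk.injEq]
    refine ⟨by rw [map_neg, neg_sub_neg, ← neg_sub, h2, neg_neg], ?_⟩
    have h5 : S (-τ g - ρ (σ (σ a))) - (-τ g - ρ (σ (σ a)))
        = -(S (τ g) - τ g) - (S (ρ (σ (σ a))) - ρ (σ (σ a))) := by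
      rw [map_sub, map_neg]; abel
    rw [h5, h3, map_neg, hg]
    abel

variable {U : V →ₗ[k] W} (hU : ∀ a, e (U a) = 0)
  (hU' : ∀ a, T a = a → S (U a) - U a = ρ a - e (ρ a))
include hU hU'

/-- `U a` is a particular solution of the equation for `b`, so the solutions differ from it by
`S`-invariants. -/
lemma mem_ker_sq_iff' (a : V) (b : W) :
    (a, b) ∈ LinearMap.ker ((κ - 1) ^ 2) ↔ T a = a ∧ S (b - U a) = b - U a := by
  rw [mem_ker_sq_iff hT hS hκ]
  refine and_congr_right fun ha => ?_
  rw [← hU' a ha, map_sub, ← sub_eq_zero, ← sub_eq_zero (a := S b - S (U a))]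
  constructor <;> intro h <;> rw [← h] <;> abel

-- The subtracted pair is the component of `(x, y)` in the kernel. Its term in `ρ` is forced by the
-- image condition, as `σ (x - E x) = σ x - E (σ x)`.
omit hU' in
lemma sub_mem_range_sq (x : V) (y : W) :
    (x, y) - (E x, U (E x) + (e y - e (ρ (σ x - E (σ x))))) ∈
      LinearMap.range ((κ - 1) ^ 2) := by
  rw [Prod.mk_sub_mk, mem_range_sq_iff hT hS hκ]
  refine ⟨by rw [map_sub, hT.idem, sub_self], ?_⟩
  rw [map_sub e, map_add e, map_sub e (e y), hU, hS.idem, hS.idem, map_sub σ, hT.comm'_apply]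
  abel

lemma isCompl_ker_range_sq :
    IsCompl (LinearMap.ker ((κ - 1) ^ 2)) (LinearMap.range ((κ - 1) ^ 2)) := by
  constructor
  · rw [Submodule.disjoint_def]
    rintro ⟨a, b⟩ h1 h2
    rw [mem_ker_sq_iff hT hS hκ] at h1
    rw [mem_range_sq_iff hT hS hκ, hT.apply_of_fixed h1.1] at h2
    obtain ⟨rfl, h2⟩ := h2
    simp only [map_zero, sub_zero] at h1 h2
    rw [hS.apply_of_fixed (sub_eq_zero.mp h1.2)] at h2
    rw [h2]; rfl
  · rw [codisjoint_iff, Submodule.eq_top_iff']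
    rintro ⟨x, y⟩
    rw [Submodule.mem_sup]
    refine ⟨_, ?_, _, sub_mem_range_sq hT hS hκ hU x y, add_sub_cancel _ _⟩
    rw [mem_ker_sq_iff' hT hS hκ hU hU', add_sub_cancel_left, map_sub, hS.apply_left, hS.apply_left]
    exact ⟨hT.apply_left x, rfl⟩

end Triangular

lemma smul_sum_pow_apply [Algebra ℚ k] (T : Module.End k V) (m : ℕ) {c c' : ℚ}
    (h : c = -c' / m) (a : V) :
    algebraMap ℚ k c • (∑ l ∈ Finset.range m, T ^ l) a
      = -(algebraMap ℚ k c' • average k T m a) := by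
  rw [average, LinearMap.smul_apply, smul_smul, ← map_mul, ← neg_smul, ← map_neg, h,
    mul_one_div, neg_div]

lemma symm_projectionOnto_eq {p q : Submodule k V} (hpq : IsCompl p q) (f : W ≃ₗ[k] ↥p)
    {z : V} {u : W} (h : z - f u ∈ q) : f.symm (p.projectionOnto q hpq z) = u := by
  rw [LinearEquiv.symm_apply_eq, ← sub_add_cancel z (f u), map_add,
    Submodule.projectionOnto_apply_of_mem_right _ h, zero_add, Submodule.projectionOnto_apply_left]

end Averaging

/-! ### The isomorphism `Ψ` onto the generalized eigenspace -/

section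

variable {k A : Type*} {M : Type*} [CommRing k] [Ring A] [Algebra k A]
  [AddCommGroup M] [Module k M] [Module A M] [Module Aᵐᵒᵖ M] [IsScalarTower k A M]
  [IsScalarTower k Aᵐᵒᵖ M] {K : Subalgebra k A} (μ : AssocBimoduleMap k A M)

lemma karoubi_sub_one_apply (v w : ℕ) (a : X M K v (w + 1)) (b : X M K v w) :
    (karoubi K μ v w - 1) (a, b)
      = (t M K v (w + 1) a - a, t M K v w b - b - rho K μ v w (v + w) a) := by
  have : (karoubi K μ v w - 1) (a, b) = (t M K v (w + 1) a + 0 - a,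
      t M K v w b + (d' K μ v w a - d K μ v w a) - b) := rfl
  rw [this, d, LinearMap.add_apply, add_zero, Prod.mk.injEq]
  refine ⟨rfl, ?_⟩
  abel

variable [Algebra ℚ k]

lemma isAverage_t (v m : ℕ) :
    IsAverage (t M K v m) (average k (t M K v m) m) (sigma' M K v m) := by
  rcases Nat.eq_zero_or_pos m with rfl | hm
  · have := subsingleton_X_zero (M := M) (K := K) v
    have : Subsingleton (Module.End k (X M K v 0)) := ⟨fun f g => LinearMap.ext fun x =>
      Subsingleton.elim _ _⟩
    constructor <;> exact Subsingleton.elim _ _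
  · exact isAverage_average hm (t_pow M K v m)

lemma average_t_apply (v m : ℕ) (x : X M K v m) :
    average k (t M K v m) m x = algebraMap ℚ k (1 / (m : ℚ)) • Nm M K v m x := rfl

lemma t_Nm (v m : ℕ) (x : X M K v m) : t M K v m (Nm M K v m x) = Nm M K v m x := by
  have : (1 - t M K v m) * Nm M K v m = 0 := by
    have := mul_neg_geom_sum (t M K v m) m
    rw [Nm, this, t_pow, sub_self]
  exact (sub_eq_zero.mp (LinearMap.congr_fun this x)).symm

lemma upsilon_apply (v w : ℕ) (a : X M K v (w + 1)) :
    upsilon K μ v w a = - sigma' M K v w (d K μ v w a)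
      + average k (t M K v w) w (sigma' M K v w (d K μ v w a)) := by
  have : upsilon K μ v w a = - sigma' M K v w (d K μ v w a)
      + NBar M K v w (algebraMap ℚ k (1 / (w : ℚ)) • brk M K v w
        (sigma' M K v w (d K μ v w a))) := rfl
  rw [this, map_smul]
  rfl

lemma average_upsilon (v w : ℕ) (a : X M K v (w + 1)) :
    average k (t M K v w) w (upsilon K μ v w a) = 0 := by
  rw [upsilon_apply, map_add, map_neg, (isAverage_t v w).idem, neg_add_cancel]

/-- The invariant summand of `Υ a` is killed by `t - 1`, and `(1 - t) σ' d a = (1 - e) d a`. The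
part `N ϱ_n a` of `d a` is invariant, so `1 - e` leaves only `ϱ_n a`. -/
lemma t_upsilon_sub (v w : ℕ) (a : X M K v (w + 1)) (ha : t M K v (w + 1) a = a) :
    t M K v w (upsilon K μ v w a) - upsilon K μ v w a
      = rho K μ v w (v + w) a - average k (t M K v w) w (rho K μ v w (v + w) a) := by
  have hS := isAverage_t (K := K) (M := M) v w
  have h := hS.sub_apply (d K μ v w a)
  rw [upsilon_apply, map_add, map_neg, hS.apply_left, add_sub_add_right_eq_sub, neg_sub_neg, h,
    d_apply_of_fixed μ v w a ha, map_add, hS.apply_of_fixed (t_Nm v w _), add_sub_add_left_eq_sub]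

lemma Psi_brk (v w : ℕ) (x : X M K v (w + 1)) (y : X M K v w) :
    Psi K μ v w (brk M K v (w + 1) x, brk M K v w y)
      = (average k (t M K v (w + 1)) (w + 1) x,
        upsilon K μ v w (average k (t M K v (w + 1)) (w + 1) x) + Nm M K v w y) := by
  have : Psi K μ v w (brk M K v (w + 1) x, brk M K v w y)
      = (algebraMap ℚ k (1 / ((w : ℚ) + 1)) • Nm M K v (w + 1) x + 0,
        algebraMap ℚ k (1 / ((w : ℚ) + 1)) • upsilon K μ v w (Nm M K v (w + 1) x)
          + Nm M K v w y) := rfl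
  rw [this, average_t_apply, map_smul, add_zero, Nat.cast_succ]

lemma mem_harmonicSub_iff (v w : ℕ) (a : X M K v (w + 1)) (b : X M K v w) :
    (a, b) ∈ harmonicSub K μ v w ↔ t M K v (w + 1) a = a ∧
      t M K v w (b - upsilon K μ v w a) = b - upsilon K μ v w a :=
  mem_ker_sq_iff' (isAverage_t v (w + 1)) (isAverage_t v w) (karoubi_sub_one_apply μ v w)
    (average_upsilon μ v w) (t_upsilon_sub μ v w) a b

lemma Psi_mem (v w : ℕ) (z : XTilde M K v w) : Psi K μ v w z ∈ harmonicSub K μ v w := by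
  obtain ⟨x, y⟩ := z
  obtain ⟨x, rfl⟩ := Submodule.mkQ_surjective _ x
  obtain ⟨y, rfl⟩ := Submodule.mkQ_surjective _ y
  have := Psi_brk μ v w x y
  rw [brk, brk] at this
  rw [this, mem_harmonicSub_iff, add_sub_cancel_left]
  exact ⟨(isAverage_t v (w + 1)).apply_left x, t_Nm v w y⟩

/-- The homotopy gives `x = (1 - t) σ' x` when the average of `x` vanishes. -/
lemma brk_eq_zero_of_average_eq_zero {v m : ℕ} {x : X M K v m}
    (hx : average k (t M K v m) m x = 0) : brk M K v m x = 0 := by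
  rw [brk, Submodule.mkQ_apply, Submodule.Quotient.mk_eq_zero]
  refine ⟨sigma' M K v m x, ?_⟩
  have := (isAverage_t (K := K) (M := M) v m).sub_apply x
  rwa [hx, sub_zero] at this

lemma Psi_injective (v w : ℕ) : Function.Injective (Psi K μ v w) := by
  rw [injective_iff_map_eq_zero]
  rintro ⟨x, y⟩ h
  obtain ⟨x, rfl⟩ := Submodule.mkQ_surjective _ x
  obtain ⟨y, rfl⟩ := Submodule.mkQ_surjective _ y
  have h2 := Psi_brk μ v w x y
  rw [brk, brk, h, eq_comm, Prod.mk_eq_zero] at h2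
  obtain ⟨hx, hy⟩ := h2
  rw [hx, map_zero, zero_add] at hy
  rw [Prod.mk_eq_zero]
  refine ⟨brk_eq_zero_of_average_eq_zero hx, brk_eq_zero_of_average_eq_zero ?_⟩
  rw [average_t_apply, hy, smul_zero]

lemma exists_Psi_eq (v w : ℕ) {z : XDD M K v w} (hz : z ∈ harmonicSub K μ v w) :
    ∃ u, Psi K μ v w u = z := by
  obtain ⟨a, b⟩ := z
  rw [mem_harmonicSub_iff] at hz
  -- `Ψ` carries a factor `1 / (w + 1)` on the first summand only, so the second entry has to be
  -- divided by `w` for `N` to become the average.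
  refine ⟨(brk M K v (w + 1) a, brk M K v w
    (algebraMap ℚ k (1 / (w : ℚ)) • (b - upsilon K μ v w a))), ?_⟩
  rw [Psi_brk, map_smul, ← average_t_apply, (isAverage_t v (w + 1)).apply_of_fixed hz.1,
    (isAverage_t v w).apply_of_fixed hz.2, add_sub_cancel]

variable (K) in
/-- `Ψ` as an isomorphism onto the generalized eigenspace `ker (κ - 1)²`. -/
noncomputable def psiEquiv (v w : ℕ) : XTilde M K v w ≃ₗ[k] ↥(harmonicSub K μ v w) :=
  LinearEquiv.ofBijective ((Psi K μ v w).codRestrict _ (Psi_mem μ v w))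
    ⟨fun a b h => Psi_injective μ v w (congrArg Subtype.val h), fun ⟨z, hz⟩ => by
      obtain ⟨u, hu⟩ := exists_Psi_eq μ v w hz
      exact ⟨u, Subtype.ext hu⟩⟩

lemma isCompl_harmonicSub (v w : ℕ) :
    IsCompl (harmonicSub K μ v w) (antiharmonicSub K μ v w) :=
  isCompl_ker_range_sq (isAverage_t v (w + 1)) (isAverage_t v w) (karoubi_sub_one_apply μ v w)
    (average_upsilon μ v w) (t_upsilon_sub μ v w)

lemma psiEquiv_symm_projectionOnto (v w : ℕ) {z : XDD M K v w} {u : XTilde M K v w}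
    (h : z - Psi K μ v w u ∈ antiharmonicSub K μ v w) :
    (psiEquiv K μ v w).symm ((harmonicSub K μ v w).projectionOnto (antiharmonicSub K μ v w)
      (isCompl_harmonicSub μ v w) z) = u :=
  symm_projectionOnto_eq (isCompl_harmonicSub μ v w) (psiEquiv K μ v w) h

/-- `Ψ⁻¹ P (x, y)` is given by any `z` such that `N z` is the invariant part of
`y - ϱ_n (1 - E) σ' x`. -/
lemma psiEquiv_symm_projectionOnto_mk (v w : ℕ) (x : X M K v (w + 1)) (y z : X M K v w)
    (hz : Nm M K v w z = average k (t M K v w) w y - average k (t M K v w) w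
      (rho K μ v w (v + w) (sigma' M K v (w + 1) x
        - average k (t M K v (w + 1)) (w + 1) (sigma' M K v (w + 1) x)))) :
    (psiEquiv K μ v w).symm ((harmonicSub K μ v w).projectionOnto (antiharmonicSub K μ v w)
      (isCompl_harmonicSub μ v w) (x, y)) = (brk M K v (w + 1) x, brk M K v w z) := by
  apply psiEquiv_symm_projectionOnto
  rw [Psi_brk, hz]
  exact sub_mem_range_sq (isAverage_t v (w + 1)) (isAverage_t v w) (karoubi_sub_one_apply μ v w)
    (average_upsilon μ v w) x y

end
end CleftExt

/-! ### The formulas for `P̃` -/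

namespace CleftExt
section
variable {k A : Type*} {M : Type*} [CommRing k] [Ring A] [Algebra k A]
  [AddCommGroup M] [Module k M] [Module A M] [Module Aᵐᵒᵖ M] [IsScalarTower k A M]
  [IsScalarTower k Aᵐᵒᵖ M] {K : Subalgebra k A} (μ : AssocBimoduleMap k A M) [Algebra ℚ k]

lemma psiEquiv_symm_projectionOnto_inr (v w : ℕ) (y : X M K v w) :
    (psiEquiv K μ v w).symm ((harmonicSub K μ v w).projectionOnto (antiharmonicSub K μ v w)
      (isCompl_harmonicSub μ v w) (0, y)) = algebraMap ℚ k (1 / (w : ℚ)) • (0, brk M K v w y) := by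
  rw [psiEquiv_symm_projectionOnto_mk μ v w 0 y (algebraMap ℚ k (1 / (w : ℚ)) • y), map_zero,
    map_smul, Prod.smul_mk, smul_zero]
  rw [map_smul, ← average_t_apply]
  simp only [map_zero, sub_zero]

lemma psiEquiv_symm_projectionOnto_inl_zero (v : ℕ) (x : X M K v (0 + 1)) :
    (psiEquiv K μ v 0).symm ((harmonicSub K μ v 0).projectionOnto (antiharmonicSub K μ v 0)
      (isCompl_harmonicSub μ v 0) (x, 0)) = (brk M K v (0 + 1) x, 0) := by
  have := subsingleton_X_zero (M := M) (K := K) v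
  rw [psiEquiv_symm_projectionOnto_mk μ v 0 x 0 0 (Subsingleton.elim _ _), map_zero]

lemma psiEquiv_symm_projectionOnto_inl (v : ℕ) {w : ℕ} (hw : 0 < w) (x : X M K v (w + 1)) :
    (psiEquiv K μ v w).symm ((harmonicSub K μ v w).projectionOnto (antiharmonicSub K μ v w)
      (isCompl_harmonicSub μ v w) (x, 0)) = (brk M K v (w + 1) x, 0)
        + ∑ i ∈ Finset.range (w + 1), algebraMap ℚ k ((2 * (i : ℚ) - w) / (2 * w * (w + 1))) •
            ((0 : XBar M K v (w + 1)),
              brk M K v w (rho K μ v w (v + w) ((t M K v (w + 1) ^ i) x))) := by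
  have hσ : sigma' M K v (w + 1) x
        - average k (t M K v (w + 1)) (w + 1) (sigma' M K v (w + 1) x)
      = ∑ j ∈ Finset.range (w + 1),
        algebraMap ℚ k ((((w + 1 : ℕ) : ℚ) - 1 - 2 * j) / (2 * ((w + 1 : ℕ) : ℚ))) •
          (t M K v (w + 1) ^ j) x := by
    have h := LinearMap.congr_fun
      (averageHomotopy_sub (k := k) (R := Module.End k (X M K v (w + 1))) (Nat.succ_pos w) (t_pow M K v (w + 1))) x
    rw [LinearMap.sum_apply] at h
    exact h
  rw [psiEquiv_symm_projectionOnto_mk μ v w x 0 (∑ i ∈ Finset.range (w + 1),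
    algebraMap ℚ k ((2 * (i : ℚ) - w) / (2 * w * (w + 1))) •
      rho K μ v w (v + w) ((t M K v (w + 1) ^ i) x))]
  · ext
    · simp [Prod.fst_sum]
    · simp [Prod.snd_sum]
  · have hw' : (w : ℚ) ≠ 0 := by exact_mod_cast hw.ne'
    rw [hσ, map_zero, zero_sub]
    simp only [map_sum, map_smul]
    rw [← Finset.sum_neg_distrib]
    refine Finset.sum_congr rfl fun i _ => ?_
    -- The coefficient of `t^i` in `(1 - E) σ'` is `(w - 2 i) / (2 (w + 1))`; the factor `-1 / w`
    -- comes from the minus sign in the kernel component and from `e = N / w`.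
    refine smul_sum_pow_apply (t M K v w) w ?_ _
    push_cast
    field_simp
    ring

end
end CleftExt

theorem mainTheorem11 {k A M : Type*} [CommRing k] [Algebra ℚ k] [Ring A] [Algebra k A]
    [AddCommGroup M] [Module k M] [Module A M] [Module Aᵐᵒᵖ M] [IsScalarTower k A M]
    [IsScalarTower k Aᵐᵒᵖ M] [SMulCommClass A Aᵐᵒᵖ M]
    (μ : CleftExt.AssocBimoduleMap k A M) (K : Subalgebra k A) (v w : ℕ) :
    ∃ (hc : IsCompl (CleftExt.harmonicSub K μ v w) (CleftExt.antiharmonicSub K μ v w))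
      (Ψ : CleftExt.XTilde M K v w ≃ₗ[k] ↥(CleftExt.harmonicSub K μ v w)),
      (∀ z, (Ψ z : CleftExt.XDD M K v w) = CleftExt.Psi K μ v w z) ∧
      ∀ Pt : CleftExt.XDD M K v w →ₗ[k] CleftExt.XTilde M K v w,
        Pt = Ψ.symm.toLinearMap ∘ₗ
          (CleftExt.harmonicSub K μ v w).projectionOnto (CleftExt.antiharmonicSub K μ v w) hc →
        (0 < w → ∀ y : CleftExt.X M K v w,
          Pt (0, y) = algebraMap ℚ k (1 / (w : ℚ)) • (0, CleftExt.brk M K v w y)) ∧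
        (w = 0 → ∀ x : CleftExt.X M K v (w + 1),
          Pt (x, 0) = (CleftExt.brk M K v (w + 1) x, 0)) ∧
        (0 < w → ∀ x : CleftExt.X M K v (w + 1),
          Pt (x, 0) = (CleftExt.brk M K v (w + 1) x, 0)
            + ∑ i ∈ Finset.range (w + 1),
                algebraMap ℚ k ((2 * (i : ℚ) - w) / (2 * w * (w + 1))) •
                  ((0 : CleftExt.XBar M K v (w + 1)),
                    CleftExt.brk M K v w
                      (CleftExt.rho K μ v w (v + w) ((CleftExt.t M K v (w + 1) ^ i) x)))) := by
  refine ⟨CleftExt.isCompl_harmonicSub μ v w, CleftExt.psiEquiv K μ v w, fun _ => rfl, ?_⟩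
  rintro _ rfl
  refine ⟨fun _ y => CleftExt.psiEquiv_symm_projectionOnto_inr μ v w y, ?_,
    fun hw x => CleftExt.psiEquiv_symm_projectionOnto_inl μ v hw x⟩
  rintro rfl x
  exact CleftExt.psiEquiv_symm_projectionOnto_inl_zero μ v x
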